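/- Let $P$ be a definite logic program, i.e. a finite set of definite clauses, over a signature of function and predicate symbols and countably many variables, and let $S$ be a set of atoms (atomic queries). Write $\mathit{rel}(A)$ for the predicate symbol of an atom $A$. Notions used: - A predicate $p$ refers to $q$ if some clause of $P$ has $p$ in its head and $q$ in its body; "depends on" is the transitive closure of "refers to"; $p\backsimeq q$ (mutually recursive) means that $p$ depends on $q$ and $q$ depends on $p$. - LD-derivations are SLD-derivations (with most general unifiers and with clause variants standardized apart) that always select the leftmost atom. $P$ LD-terminates for a query $Q$ if the LD-tree for $(P,Q)$ is finite. The call set $\mathit{Call}(P,S)$ is the set of all atoms $A$ such that a variant of $A$ is the selected atom in some LD-derivation for $(P,Q)$ with $Q\in S$. - A polynomial interpretation $I$ maps each function or predicate symbol $f$ of arity $n$ to a polynomial $p_f(X_1,\ldots,X_n)$ with coefficients in $\mathbb{N}$. It induces the level mapping on terms and atoms with $|X|_I=X$ for variables $X$ and $|f(t_1,\ldots,t_n)|_I=p_f(|t_1|_I,\ldots,|t_n|_I)$. For terms or atoms $s,t$ let $s\succsim_I t$ (resp. $s\succ_I t$) mean that $|s|_I\ge|t|_I$ (resp. $|s|_I>|t|_I$)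 for all values in $\mathbb{N}$ of the variables, and let $s\approx_I t$ mean $s\succsim_I t$ and $t\succsim_I s$. A set of atoms is rigid w.r.t. $I$ if $A\approx_I A\sigma$ for each of its elements $A$ and every substitution $\sigma$. - An interargument relation for a predicate $p$ of arity $n$ w.r.t. $I$ is a set $R_p=\{p(t_1,\ldots,t_n)\mid t_1,\ldots,t_n \text{ terms},\ \varphi_p(t_1,\ldots,t_n)\}$, where $\varphi_p$ is a Boolean combination (possibly just "true") of inequalities $s\succsim_I s'$ and $s\succ_I s'$ with $s,s'$ built from $t_1,\ldots,t_n$ by function symbols. It is valid if for all terms $t_1,\ldots,t_n$, $P\models p(t_1,\ldots,t_n)$ (the universal closure is a logical consequence of $P$) implies $p(t_1,\ldots,t_n)\in R_p$. Statement. Let $I$ be a polynomial interpretation such that $\mathit{Call}(P,S)$ is rigid w.r.t. $I$, and suppose that for each predicate $p$ in $P$ there is a valid interargument relation $R_p$ w.r.t. $I$ such that the following holds: for every clause $A \leftarrow B_1,\ldots,B_n$ in $P$, every $i$ with $\mathit{rel}(B_i)\backsimeq\mathit{rel}(A)$, and every substitution $\theta$ with $B_j\theta\in R_{\mathit{rel}(B_j)}$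 for all $j<i$, we have $A\theta\succ_I B_i\theta$. Then $P$ LD-terminates for every query in $S$. -/

import Mathlib

universe u v

namespace LogicProg

/-! ### Syntax of definite logic programs

The first-order language `L` is the signature (function and predicate symbols); the variables are
the natural numbers, and terms are Mathlib's first-order terms `L.Term ℕ`. -/

/-- A predicate symbol, together with its arity. -/
abbrev Pred (L : FirstOrder.Language.{u, v}) : Type v := Σ n : ℕ, L.Relations n

/-- An atom `p(t₁, …, tₙ)`. -/
structure Atom (L : FirstOrder.Language.{u, v}) where
  /-- the predicate symbol of the atom -/
  rel : Pred L
  /-- the arguments of the atom -/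
  args : Fin rel.1 → L.Term ℕ

/-- A definite clause `head :- body`. -/
structure Clause (L : FirstOrder.Language.{u, v}) where
  head : Atom L
  body : List (Atom L)

/-- A definite logic program: a finite set of definite clauses. -/
abbrev Program (L : FirstOrder.Language.{u, v}) := Finset (Clause L)

/-- A goal (query): a finite sequence of atoms; its leftmost atom is the selected one. -/
abbrev Goal (L : FirstOrder.Language.{u, v}) := List (Atom L)

/-- A substitution: it moves only finitely many variables. -/
structure Subst (L : FirstOrder.Language.{u, v}) where
  toFun : ℕ → L.Term ℕ
  finite_support : {x | toFun x ≠ FirstOrder.Language.Term.var x}.Finite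

variable {L : FirstOrder.Language.{u, v}}

/-- `A.subst σ` is the instance `Aσ`. -/
def Atom.subst (A : Atom L) (σ : Subst L) : Atom L :=
  ⟨A.rel, fun i => (A.args i).subst σ.toFun⟩

/-- The instance of a goal. -/
def Goal.subst (G : Goal L) (σ : Subst L) : Goal L := G.map fun A => A.subst σ

/-- The instance of a clause. -/
def Clause.subst (c : Clause L) (σ : Subst L) : Clause L :=
  ⟨c.head.subst σ, Goal.subst c.body σ⟩

/-- The variables of an atom. -/
def Atom.vars (A : Atom L) : Set ℕ := {x | ∃ i, x ∈ (A.args i).varFinset}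

/-- The variables of a goal. -/
def Goal.vars (G : Goal L) : Set ℕ := {x | ∃ A ∈ G, x ∈ A.vars}

/-- The variables of a clause. -/
def Clause.vars (c : Clause L) : Set ℕ := c.head.vars ∪ Goal.vars c.body

/-- The variables of a substitution: those it moves and those in the terms it binds them to. -/
def Subst.vars (σ : Subst L) : Set ℕ :=
  {x | ∃ y, σ.toFun y ≠ FirstOrder.Language.Term.var y ∧ (x = y ∨ x ∈ (σ.toFun y).varFinset)}

/-- Two atoms are variants: each is an instance of the other. -/
def Atom.IsVariant (A B : Atom L) : Prop :=
  (∃ σ, B.subst σ = A) ∧ ∃ σ, A.subst σ = B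

/-- Two clauses are variants: each is an instance of the other. -/
def Clause.IsVariant (c d : Clause L) : Prop :=
  (∃ σ, d.subst σ = c) ∧ ∃ σ, c.subst σ = d

/-- `θ` is a most general unifier of the atoms `A` and `B`. -/
def IsMGU (θ : Subst L) (A B : Atom L) : Prop :=
  A.subst θ = B.subst θ ∧
    ∀ τ : Subst L, A.subst τ = B.subst τ →
      ∃ δ : Subst L, ∀ x, τ.toFun x = (θ.toFun x).subst δ.toFun

/-! ### Dependency between predicates -/

/-- The predicate `p` occurs in the program. -/
def Occurs (P : Program L) (p : Pred L) : Prop :=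
  ∃ c ∈ P, c.head.rel = p ∨ ∃ B ∈ c.body, B.rel = p

/-- `p` refers to `q`: some clause has `p` in its head and `q` in its body. -/
def RefersTo (P : Program L) (p q : Pred L) : Prop :=
  ∃ c ∈ P, c.head.rel = p ∧ ∃ B ∈ c.body, B.rel = q

/-- `p` depends on `q`: transitive closure of `RefersTo`. -/
def DependsOn (P : Program L) : Pred L → Pred L → Prop := Relation.TransGen (RefersTo P)

/-- `p` and `q` are mutually recursive. -/
def MutuallyRecursive (P : Program L) (p q : Pred L) : Prop :=
  DependsOn P p q ∧ DependsOn P q p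

/-! ### LD-derivations and LD-trees -/

/-- The data of a resolution step: a program clause, the variant of it that is used as input
clause, and the most general unifier. -/
structure Step (L : FirstOrder.Language.{u, v}) where
  clause : Clause L
  input : Clause L
  mgu : Subst L

/-- The goal reached from `Q` by a sequence of steps (latest step first): the leftmost atom is
replaced by the body of the input clause and the unifier is applied. -/
def goalAfter (Q : Goal L) : List (Step L) → Goal L
  | [] => Q
  | s :: D => Goal.subst (s.input.body ++ (goalAfter Q D).tail) s.mgu

/-- The variables used so far: those of the query, the input clauses and the unifiers. -/
def usedVars (Q : Goal L) : List (Step L) → Set ℕ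
  | [] => Goal.vars Q
  | s :: D => s.input.vars ∪ s.mgu.vars ∪ usedVars Q D

/-- `s` is a legal resolution step for the goal reached by `D`, with the leftmost atom selected and
the input clause standardized apart from everything used before. -/
def IsLDStep (P : Program L) (Q : Goal L) (D : List (Step L)) (s : Step L) : Prop :=
  s.clause ∈ P ∧ s.input.IsVariant s.clause ∧ Disjoint s.input.vars (usedVars Q D) ∧
    ∃ A, (goalAfter Q D).head? = some A ∧ IsMGU s.mgu A s.input.head

/-- A sequence of steps (latest step first) is a finite LD-derivation for `(P, Q)`. -/
def IsLDDerivation (P : Program L) (Q : Goal L) : List (Step L) → Prop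
  | [] => True
  | s :: D => IsLDDerivation P Q D ∧ IsLDStep P Q D s

/-- `T` is (the set of nodes of) an LD-tree for `(P, Q)`. A node is identified with the LD-derivation
that leads to it from the root, and it has exactly one child for every program clause that has a
resolvent with the goal of the node. -/
structure IsLDTree (P : Program L) (Q : Goal L) (T : Set (List (Step L))) : Prop where
  root : [] ∈ T
  parent : ∀ s D, s :: D ∈ T → D ∈ T
  derivation : ∀ D ∈ T, IsLDDerivation P Q D
  child : ∀ D ∈ T, ∀ c ∈ P, (∃ s, s.clause = c ∧ IsLDStep P Q D s) →
    ∃! s : Step L, s.clause = c ∧ s :: D ∈ T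

/-- The LD-tree is unique up to the choice of input variants and unifiers; at least one exists. -/
theorem exists_isLDTree (P : Program L) (Q : Goal L) : ∃ T, IsLDTree P Q T := by
  classical
  let T : Set (List (Step L)) := {D | List.rec True
    (fun s D ih => ih ∧ IsLDStep P Q D s ∧
      ∃ h : ∃ s', s'.clause = s.clause ∧ IsLDStep P Q D s', s = h.choose) D}
  have hcons : ∀ s D, s :: D ∈ T ↔ D ∈ T ∧ IsLDStep P Q D s ∧
      ∃ h : ∃ s', s'.clause = s.clause ∧ IsLDStep P Q D s', s = h.choose := fun _ _ => Iff.rfl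
  refine ⟨T, trivial, fun s D h => ((hcons s D).1 h).1, ?_, ?_⟩
  · intro D
    induction D with
    | nil => exact fun _ => trivial
    | cons s D ih => exact fun h => ⟨ih ((hcons s D).1 h).1, ((hcons s D).1 h).2.1⟩
  · intro D hD c _ h
    refine ⟨h.choose, ⟨h.choose_spec.1, (hcons _ _).2 ⟨hD, h.choose_spec.2, ?_⟩⟩, ?_⟩
    · have hc := h.choose_spec.1
      generalize hs : h.choose = s at hc
      subst hc
      exact ⟨h, hs.symm⟩
    · rintro s ⟨rfl, hs⟩
      exact ((hcons _ _).1 hs).2.2.2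

/-- The query `Q` LD-terminates for `P`: the LD-tree for `(P, Q)` is finite, whichever input
variants and unifiers are chosen. -/
def LDTerminates (P : Program L) (Q : Goal L) : Prop :=
  ∀ T, IsLDTree P Q T → T.Finite

/-- The call set: all atoms with a variant that is the selected atom in some LD-derivation for
an atomic query of `S`. -/
def callSet (P : Program L) (S : Set (Atom L)) : Set (Atom L) :=
  {A | ∃ Q ∈ S, ∃ D, IsLDDerivation P [Q] D ∧
    ∃ A', (goalAfter [Q] D).head? = some A' ∧ A'.IsVariant A}

/-! ### Logical consequence -/

/-- Truth of an atom in a structure under a valuation of the variables. -/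
def Atom.Realize {M : Type*} [L.Structure M] (A : Atom L) (val : ℕ → M) : Prop :=
  FirstOrder.Language.Structure.RelMap A.rel.2 fun i => (A.args i).realize val

/-- `M` is a model of `P`: every clause, universally closed, is true in `M`. -/
def IsModel (M : Type*) [L.Structure M] (P : Program L) : Prop :=
  ∀ c ∈ P, ∀ val : ℕ → M, (∀ B ∈ c.body, B.Realize val) → c.head.Realize val

/-- `P ⊨ A`: the universal closure of `A` is true in every model of `P`. -/
def Entails (P : Program L) (A : Atom L) : Prop :=
  ∀ (M : Type (max u v)) [Nonempty M] [L.Structure M], IsModel M P → ∀ val : ℕ → M, A.Realize val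

/-! ### Interargument relations -/

/-- Boolean combinations of inequalities `s ≿ s'`, `s ≻ s'` between terms built by function symbols
from `n` argument places. -/
inductive IneqExpr (L : FirstOrder.Language.{u, v}) (n : ℕ) where
  | tru : IneqExpr L n
  | ge (s s' : L.Term (Fin n)) : IneqExpr L n
  | gt (s s' : L.Term (Fin n)) : IneqExpr L n
  | not (φ : IneqExpr L n) : IneqExpr L n
  | and (φ ψ : IneqExpr L n) : IneqExpr L n
  | or (φ ψ : IneqExpr L n) : IneqExpr L n

/-- Truth of `φ(t₁, …, tₙ)` for given relations `≿` and `≻` on terms. -/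
def IneqExpr.Holds {n : ℕ} (ge gt : L.Term ℕ → L.Term ℕ → Prop) (t : Fin n → L.Term ℕ) :
    IneqExpr L n → Prop
  | .tru => True
  | .ge s s' => ge (s.subst t) (s'.subst t)
  | .gt s s' => gt (s.subst t) (s'.subst t)
  | .not φ => ¬ φ.Holds ge gt t
  | .and φ ψ => φ.Holds ge gt t ∧ ψ.Holds ge gt t
  | .or φ ψ => φ.Holds ge gt t ∨ ψ.Holds ge gt t

/-- `R` is an interargument relation for `p` w.r.t. the relations `≿` and `≻` on terms. -/
def IsInterargRel (ge gt : L.Term ℕ → L.Term ℕ → Prop) (p : Pred L) (R : Set (Atom L)) : Prop :=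
  ∃ φ : IneqExpr L p.1, R = {A | ∃ t : Fin p.1 → L.Term ℕ, A = ⟨p, t⟩ ∧ φ.Holds ge gt t}

/-- `R` is valid for `p` in `P`: it contains all atoms `p(t₁, …, tₙ)` that follow from `P`. -/
def IsValidRel (P : Program L) (p : Pred L) (R : Set (Atom L)) : Prop :=
  ∀ t : Fin p.1 → L.Term ℕ, Entails P ⟨p, t⟩ → (⟨p, t⟩ : Atom L) ∈ R

/-! ### Polynomial interpretations -/

/-- A polynomial interpretation: each function or predicate symbol of arity `n` is mapped to a
polynomial in `n` variables with natural coefficients. -/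
structure PolyInterp (L : FirstOrder.Language.{u, v}) where
  func : ∀ {n : ℕ}, L.Functions n → MvPolynomial (Fin n) ℕ
  pred : ∀ {n : ℕ}, L.Relations n → MvPolynomial (Fin n) ℕ

/-- The quasi-order `p ≿ q` on polynomials: `p ≥ q` for all natural values of the variables. -/
def PolyGE (p q : MvPolynomial ℕ ℕ) : Prop :=
  ∀ x : ℕ → ℕ, MvPolynomial.eval x q ≤ MvPolynomial.eval x p

/-- The strict order `p ≻ q` on polynomials: `p > q` for all natural values of the variables. -/
def PolyGT (p q : MvPolynomial ℕ ℕ) : Prop :=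
  ∀ x : ℕ → ℕ, MvPolynomial.eval x q < MvPolynomial.eval x p

namespace PolyInterp

/-- The level mapping on terms. -/
noncomputable def termLevel (I : PolyInterp L) : L.Term ℕ → MvPolynomial ℕ ℕ
  | .var x => MvPolynomial.X x
  | .func f t => MvPolynomial.bind₁ (fun i => I.termLevel (t i)) (I.func f)

/-- The level mapping on atoms. -/
noncomputable def atomLevel (I : PolyInterp L) (A : Atom L) : MvPolynomial ℕ ℕ :=
  MvPolynomial.bind₁ (fun i => I.termLevel (A.args i)) (I.pred A.rel.2)

/-- `s ≿ t` for terms. -/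
def TermGE (I : PolyInterp L) (s t : L.Term ℕ) : Prop := PolyGE (I.termLevel s) (I.termLevel t)

/-- `s ≻ t` for terms. -/
def TermGT (I : PolyInterp L) (s t : L.Term ℕ) : Prop := PolyGT (I.termLevel s) (I.termLevel t)

/-- `A ≿ B` for atoms. -/
def AtomGE (I : PolyInterp L) (A B : Atom L) : Prop := PolyGE (I.atomLevel A) (I.atomLevel B)

/-- `A ≻ B` for atoms. -/
def AtomGT (I : PolyInterp L) (A B : Atom L) : Prop := PolyGT (I.atomLevel A) (I.atomLevel B)

/-- A set of atoms is rigid: each of its atoms `A` is equivalent to all its instances `Aσ`. -/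
def IsRigid (I : PolyInterp L) (X : Set (Atom L)) : Prop :=
  ∀ A ∈ X, ∀ σ : Subst L, I.AtomGE A (A.subst σ) ∧ I.AtomGE (A.subst σ) A

end PolyInterp

end LogicProg

/-! An infinite LD-tree is finitely branching, so it has an infinite branch
(`IsLDTree.exists_branch`). Along it, consider the times after which the goal never gets shorter.
Let `A` be selected at such a time and resolved with a clause `c`. The next such time comes when
some first body atoms of `c` have been resolved away completely and an instance of the following one
is selected. By soundness (`exists_suffix_instance`) the corresponding instances of the earlier body
atoms follow from `P`. This gives an infinite chain of calls (`exists_calls_chain`).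

Only finitely many predicates occur, so the chain finally stays among mutually recursive ones. There
validity puts the proved atoms into their interargument relations, and the decrease condition
applies to the clause instance. Its head is an instance of the calling atom, which by rigidity has
the same level. Levels at a fixed valuation thus strictly decrease in the naturals forever, which is
absurd. -/

namespace LogicProg

variable {L : FirstOrder.Language.{u, v}}

/-! ### Substitutions -/

/-- The identity substitution. -/
def Subst.id : Subst L := ⟨FirstOrder.Language.Term.var, by simp⟩

/-- The composition of substitutions: first `σ`, then `τ`. -/
def Subst.comp (σ τ : Subst L) : Subst L where
  toFun x := (σ.toFun x).subst τ.toFun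
  finite_support := by
    refine (σ.finite_support.union τ.finite_support).subset fun x hx => ?_
    by_contra h
    simp only [Set.mem_union, Set.mem_ofPred_eq, not_or, not_not] at h
    exact hx (by simp [h.1, h.2, FirstOrder.Language.Term.subst])

theorem term_subst_subst {α β γ : Type*} (t : L.Term α) (σ : α → L.Term β) (τ : β → L.Term γ) :
    (t.subst σ).subst τ = t.subst fun x => (σ x).subst τ := by
  induction t with
  | var x => rfl
  | func f ts ih => simp [FirstOrder.Language.Term.subst, ih]

theorem term_subst_var {α : Type*} (t : L.Term α) :
    t.subst FirstOrder.Language.Term.var = t := by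
  induction t with
  | var x => rfl
  | func f ts ih => simp [FirstOrder.Language.Term.subst, ih]

theorem Atom.subst_comp (A : Atom L) (σ τ : Subst L) :
    (A.subst σ).subst τ = A.subst (σ.comp τ) := by
  simp [Atom.subst, Subst.comp, term_subst_subst]

theorem Atom.subst_id (A : Atom L) : A.subst Subst.id = A := by
  simp [Atom.subst, Subst.id, term_subst_var]

theorem Atom.rel_eq_of_subst_eq {A B : Atom L} {σ τ : Subst L} (h : A.subst σ = B.subst τ) :
    A.rel = B.rel := by
  change (A.subst σ).rel = (B.subst τ).rel
  rw [h]

theorem Atom.isVariant_refl (A : Atom L) : A.IsVariant A :=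
  ⟨⟨Subst.id, A.subst_id⟩, ⟨Subst.id, A.subst_id⟩⟩

theorem Goal.subst_append (G H : Goal L) (σ : Subst L) :
    Goal.subst (G ++ H) σ = Goal.subst G σ ++ Goal.subst H σ := by
  simp [Goal.subst]

theorem Goal.length_subst (G : Goal L) (σ : Subst L) : (Goal.subst G σ).length = G.length := by
  simp [Goal.subst]

theorem Goal.subst_comp (G : Goal L) (σ τ : Subst L) :
    Goal.subst (Goal.subst G σ) τ = Goal.subst G (σ.comp τ) := by
  simp [Goal.subst, Atom.subst_comp]

theorem Goal.subst_id (G : Goal L) : Goal.subst G Subst.id = G := by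
  simp [Goal.subst, Atom.subst_id]

theorem Atom.realize_subst {M : Type*} [L.Structure M] (A : Atom L) (σ : Subst L) (val : ℕ → M) :
    (A.subst σ).Realize val ↔ A.Realize fun x => (σ.toFun x).realize val := by
  simp [Atom.Realize, Atom.subst, FirstOrder.Language.Term.realize_subst]

/-! ### Sequences of resolution steps -/

/-- `G'` is obtained from `G` by resolving the leftmost atom with an instance of a clause of `P`,
the unifier being `θ`. -/
def Resolves (P : Program L) (G : Goal L) (θ : Subst L) (G' : Goal L) : Prop :=
  ∃ A rest, G = A :: rest ∧ ∃ c ∈ P, ∃ ρ : Subst L,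
    A.subst θ = (c.head.subst ρ).subst θ ∧ G' = Goal.subst (Goal.subst c.body ρ ++ rest) θ

theorem IsLDStep.resolves {P : Program L} {Q : Goal L} {D : List (Step L)} {s : Step L}
    (h : IsLDStep P Q D s) : Resolves P (goalAfter Q D) s.mgu (goalAfter Q (s :: D)) := by
  obtain ⟨hc, ⟨⟨ρ, hρ⟩, -⟩, -, A, hA, hmgu, -⟩ := h
  refine ⟨A, (goalAfter Q D).tail, ?_, s.clause, hc, ρ, ?_, ?_⟩
  · exact (List.cons_head?_tail hA).symm
  · rw [hmgu, ← hρ]; rfl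
  · rw [goalAfter, ← hρ]; rfl

/-- Soundness of resolution: as long as the suffix `Y` of a goal `X ++ Y` is not reached, it is only
instantiated, and what remains of `X` implies the instance of `X`. -/
theorem exists_suffix_instance {P : Program L} {G : ℕ → Goal L} {θ : ℕ → Subst L}
    (h : ∀ n, Resolves P (G n) (θ n) (G (n + 1))) {a : ℕ} {X Y : Goal L} (ha : G a = X ++ Y)
    (k : ℕ) (hk : ∀ s, a ≤ s → s < a + k → Y.length < (G s).length) :
    ∃ (σ : Subst L) (Z : Goal L), G (a + k) = Z ++ Goal.subst Y σ ∧
      ∀ (M : Type (max u v)) [L.Structure M], IsModel M P → ∀ val : ℕ → M,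
        (∀ B ∈ Z, B.Realize val) → ∀ B ∈ X, (B.subst σ).Realize val := by
  induction k with
  | zero =>
    exact ⟨Subst.id, X, by rw [Goal.subst_id]; exact ha, fun M _ _ val hX B hB => by
      rw [Atom.subst_id]; exact hX B hB⟩
  | succ k ih =>
    obtain ⟨σ, Z, hZ, hM⟩ := ih fun s h1 h2 => hk s h1 (by omega)
    obtain ⟨A, rest, hG, c, hc, ρ, hA, hG'⟩ := h (a + k)
    have hlen := hk (a + k) (by omega) (by omega)
    match Z, hZ, hM with
    -- With `Z` empty the goal would be an instance of `Y`, hence no longer than `Y`.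
    | [], hZ, _ => rw [hZ, List.nil_append, Goal.length_subst] at hlen; omega
    | A' :: Z, hZ, hM =>
      rw [hG, List.cons_append, List.cons.injEq] at hZ
      obtain ⟨rfl, rfl⟩ := hZ
      refine ⟨σ.comp (θ (a + k)), Goal.subst (Goal.subst c.body ρ ++ Z) (θ (a + k)), ?_, ?_⟩
      · rw [← add_assoc, hG', ← List.append_assoc, Goal.subst_append, Goal.subst_comp]
      · intro M _ hP val hval B hB
        rw [← Atom.subst_comp, Atom.realize_subst]
        -- Apply the induction hypothesis at the valuation precomposed with the unifier: the
        -- resolved atom is then true by its clause, the rest of the old `Z` by assumption.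
        refine hM M hP _ (fun C hC => ?_) B hB
        rw [← Atom.realize_subst]
        rcases List.mem_cons.1 hC with rfl | hC
        · rw [hA, Atom.realize_subst, Atom.realize_subst]
          refine hP c hc _ fun D hD => ?_
          rw [← Atom.realize_subst, ← Atom.realize_subst]
          exact hval _ (List.mem_map_of_mem
            (List.mem_append_left _ (List.mem_map_of_mem hD)))
        · exact hval _ (List.mem_map_of_mem (List.mem_append_right _ hC))

/-- The selected atom `A` calls the atom `B`: `B` is an instance of a body atom of a clause whose
head has the same instance as `A`, and the preceding body atoms have been proved. -/
def Calls (P : Program L) (A B : Atom L) : Prop :=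
  ∃ c ∈ P, ∃ (i : Fin c.body.length) (τ ρ : Subst L), A.subst ρ = c.head.subst τ ∧
    B = (c.body.get i).subst τ ∧ ∀ j < i, Entails P ((c.body.get j).subst τ)

/-- From time `t` on, the goals never become shorter than the one at time `t`. -/
def Persistent (G : ℕ → Goal L) (t : ℕ) : Prop := ∀ s, t ≤ s → (G t).length ≤ (G s).length

/-- Take the earliest time from `a` on at which the goal length is minimal: minimality gives
persistence, and being earliest gives the strict inequality before it. -/
theorem exists_next_persistent (G : ℕ → Goal L) (a : ℕ) :
    ∃ t, a ≤ t ∧ Persistent G t ∧ ∀ s, a ≤ s → s < t → (G t).length < (G s).length := by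
  classical
  have hex : ∃ t, a ≤ t ∧ ∀ s, a ≤ s → (G t).length ≤ (G s).length := by
    exact ⟨Function.argminOn (fun t => (G t).length) (Set.Ici a) ⟨a, Set.self_mem_Ici⟩,
      Function.argminOn_mem _ _ _, fun s hs =>
        Function.argminOn_le (fun t => (G t).length) (Set.Ici a) hs⟩
  obtain ⟨h1, h2⟩ := Nat.find_spec hex
  refine ⟨Nat.find hex, h1, fun s hs => h2 s (h1.trans hs), fun s hs hlt => ?_⟩
  by_contra hle
  exact Nat.find_min hex hlt ⟨hs, fun r hr => (not_lt.1 hle).trans (h2 r hr)⟩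

/-- By persistence the goal cannot shrink below its length at `t`, so the atoms behind the selected
one are never reached. At the next persistent time the selected atom therefore stems from the clause
body. -/
theorem Persistent.exists_calls {P : Program L} {G : ℕ → Goal L} {θ : ℕ → Subst L}
    (h : ∀ n, Resolves P (G n) (θ n) (G (n + 1))) {t : ℕ} (ht : Persistent G t) :
    ∃ t', Persistent G t' ∧ ∀ A, (G t).head? = some A →
      ∃ B, (G t').head? = some B ∧ Calls P A B := by
  obtain ⟨t', htt', hpers, hmin⟩ := exists_next_persistent G (t + 1)
  refine ⟨t', hpers, fun A hA => ?_⟩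
  obtain ⟨A', rest, hG, c, hc, ρ, hunif, hG'⟩ := h t
  obtain rfl : A' = A := by simpa [hG] using hA
  have hl1 := ht t' (by omega)
  have hlG' : (G (t + 1)).length = c.body.length + rest.length := by
    simp [hG', Goal.subst]
  have hl2 : (G t').length ≤ (G (t + 1)).length := by
    rcases htt'.eq_or_lt with h' | h'
    · rw [h']
    · exact (hmin _ le_rfl h').le
  rw [hG, List.length_cons] at hl1
  -- `i` counts the body atoms used up by time `t'`; it is less than the body length because `G t'`
  -- is longer than `rest`.
  obtain ⟨i, hi⟩ : ∃ i, i + (G t').length = c.body.length + rest.length :=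
    ⟨c.body.length + rest.length - (G t').length, by omega⟩
  have hib : i < c.body.length := by omega
  have hsplit : G (t + 1) = Goal.subst (Goal.subst (c.body.take i) ρ) (θ t) ++
      Goal.subst (Goal.subst (c.body.drop i) ρ ++ rest) (θ t) := by
    rw [hG', ← Goal.subst_append, ← List.append_assoc, ← Goal.subst_append, List.take_append_drop]
  obtain ⟨k, rfl⟩ := Nat.exists_eq_add_of_le htt'
  -- The suffix from body atom `i` on is as long as `G t'`, and all goals strictly between `t` and
  -- `t'` are longer.
  obtain ⟨σ, Z, hZ, hM⟩ := exists_suffix_instance h hsplit k fun s h1 h2 => by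
    have := hmin s h1 h2
    simp only [Goal.length_subst, List.length_append, List.length_drop]
    omega
  have hZ0 : Z = [] := by
    have := congrArg List.length hZ
    simp only [Goal.length_subst, List.length_append, List.length_drop] at this
    exact List.length_eq_zero_iff.1 (by omega)
  subst hZ0
  refine ⟨(c.body.get ⟨i, hib⟩).subst ((ρ.comp (θ t)).comp σ), ?_, c, hc, ⟨i, hib⟩,
    (ρ.comp (θ t)).comp σ, (θ t).comp σ, ?_, rfl, ?_⟩
  · rw [hZ, List.drop_eq_getElem_cons hib]
    rw [← Atom.subst_comp, ← Atom.subst_comp]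
    rfl
  · rw [← Atom.subst_comp, hunif, Atom.subst_comp _ ρ, Atom.subst_comp]
  · intro j hj M _ _ hP val
    rw [← Atom.subst_comp]
    refine hM M hP val (by simp) _ ?_
    rw [← Atom.subst_comp]
    refine List.mem_map_of_mem (List.mem_map_of_mem (List.mem_take_iff_getElem.2 ⟨j, ?_, rfl⟩))
    have : (j : ℕ) < i := hj
    simp [this]

/-- An infinite resolution sequence contains an infinite chain of calls. -/
theorem exists_calls_chain {P : Program L} {G : ℕ → Goal L} {θ : ℕ → Subst L}
    (h : ∀ n, Resolves P (G n) (θ n) (G (n + 1))) :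
    ∃ A : ℕ → Atom L, (∀ k, ∃ n, (G n).head? = some (A k)) ∧ ∀ k, Calls P (A k) (A (k + 1)) := by
  have hhead : ∀ n, ∃ A, (G n).head? = some A := fun n => by
    obtain ⟨A, rest, hG, -⟩ := h n
    exact ⟨A, by rw [hG]; rfl⟩
  choose A hA using hhead
  have hnext : ∀ t : {t // Persistent G t}, ∃ t' : {t // Persistent G t},
      Calls P (A t) (A t') := fun t => by
    obtain ⟨t', ht', hcall⟩ := t.2.exists_calls h
    obtain ⟨B, hB, hcalls⟩ := hcall _ (hA t)
    obtain rfl : A t' = B := Option.some.inj ((hA t').symm.trans hB)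
    exact ⟨⟨t', ht'⟩, hcalls⟩
  choose next hcalls using hnext
  obtain ⟨t₀, -, ht₀, -⟩ := exists_next_persistent G 0
  refine ⟨fun k => A (next^[k] ⟨t₀, ht₀⟩), fun k => ⟨_, hA _⟩, fun k => ?_⟩
  simp only [Function.iterate_succ_apply']
  exact hcalls _

/-! ### Dependency chains -/

theorem finite_setOf_occurs (P : Program L) : {p | Occurs P p}.Finite := by
  have : {p | Occurs P p} ⊆
      ⋃ c ∈ (P : Set (Clause L)), ({p | p ∈ c.head.rel :: c.body.map Atom.rel} : Set (Pred L)) := by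
    rintro p ⟨c, hc, hp⟩
    simp only [Set.mem_iUnion]
    refine ⟨c, hc, ?_⟩
    rcases hp with rfl | ⟨B, hB, rfl⟩
    · exact List.mem_cons_self
    · exact List.mem_cons_of_mem _ (List.mem_map_of_mem hB)
  exact (P.finite_toSet.biUnion fun c _ => List.finite_toSet _).subset this

/-- An infinite chain of references eventually stays within a class of mutually recursive
predicates. -/
theorem exists_forall_mutuallyRecursive {P : Program L} {p : ℕ → Pred L}
    (h : ∀ k, RefersTo P (p k) (p (k + 1))) :
    ∃ N, ∀ k, N ≤ k → MutuallyRecursive P (p (k + 1)) (p k) := by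
  have hdep : ∀ i j, i < j → DependsOn P (p i) (p j) := fun i j hij => by
    induction j, hij using Nat.le_induction with
    | base => exact .single (h i)
    | succ j _ ih => exact ih.tail (h j)
  have hocc : ∀ k, p k ∈ {p | Occurs P p} := fun k => by
    obtain ⟨c, hc, hp, -⟩ := h k
    exact ⟨c, hc, Or.inl hp⟩
  have : Finite {p | Occurs P p} := finite_setOf_occurs P
  -- Some `q` recurs infinitely often. After its occurrence at `N`, each `p (k + 1)` leads to a
  -- later `q`, which equals `p N` and so leads back to `p k`.
  obtain ⟨⟨q, hq⟩, hinf⟩ := Finite.exists_infinite_fiber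
    (fun k => (⟨p k, hocc k⟩ : {p | Occurs P p}))
  rw [Set.infinite_coe_iff] at hinf
  obtain ⟨N, hN⟩ := hinf.nonempty
  have hN : p N = q := congrArg Subtype.val hN
  refine ⟨N, fun k hk => ⟨?_, hdep k (k + 1) (by omega)⟩⟩
  obtain ⟨m, hm, hkm⟩ := hinf.exists_gt (k + 1)
  have hm : p m = q := congrArg Subtype.val hm
  have h1 := hdep (k + 1) m hkm
  rcases hk.eq_or_lt with rfl | hk
  · rwa [hm, ← hN] at h1
  · rw [hm, ← hN] at h1
    exact h1.trans (hdep N k hk)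

/-! ### LD-trees -/

/-- A child is determined by its program clause, and `P` is finite. -/
theorem IsLDTree.finite_children {P : Program L} {Q : Goal L} {T : Set (List (Step L))}
    (hT : IsLDTree P Q T) (D : List (Step L)) : {s | s :: D ∈ T}.Finite := by
  refine Set.Finite.of_finite_image (f := Step.clause)
    (P.finite_toSet.subset ?_) ?_
  · rintro _ ⟨s, hs, rfl⟩
    exact (hT.derivation _ hs).2.1
  · intro s hs s' hs' heq
    have hstep := (hT.derivation _ hs).2
    exact (hT.child D (hT.parent s D hs) s.clause hstep.1 ⟨s, rfl, hstep⟩).unique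
      ⟨rfl, hs⟩ ⟨heq.symm, hs'⟩

/-- König's lemma for LD-trees: an infinite tree has an infinite branch. -/
theorem IsLDTree.exists_branch {P : Program L} {Q : Goal L} {T : Set (List (Step L))}
    (hT : IsLDTree P Q T) (hinf : T.Infinite) :
    ∃ (D : ℕ → List (Step L)) (s : ℕ → Step L),
      (∀ n, D n ∈ T) ∧ ∀ n, D (n + 1) = s n :: D n := by
  let Big : List (Step L) → Prop := fun D => D ∈ T ∧ {D' ∈ T | D <:+ D'}.Infinite
  have hnext : ∀ D : {D // Big D}, ∃ s, Big (s :: D) := by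
    rintro ⟨D, hD, hbig⟩
    by_contra! hno
    -- If no child had infinitely many descendants, those of `D` would be `D` itself and finitely
    -- many finite sets.
    refine hbig (((Set.finite_singleton D).union
      ((hT.finite_children D).biUnion (t := fun s => {D' ∈ T | s :: D <:+ D'})
        fun s hs => ?_)).subset ?_)
    · by_contra hs'
      exact hno s ⟨hs, hs'⟩
    · rintro D' ⟨hD', E, rfl⟩
      rcases E.eq_nil_or_concat with rfl | ⟨E, s, rfl⟩
      · exact Or.inl rfl
      · refine Or.inr ?_
        simp only [List.concat_eq_append, List.append_assoc, List.singleton_append] at hD' ⊢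
        simp only [Set.mem_iUnion]
        refine ⟨s, ?_, hD', List.suffix_append _ _⟩
        clear hno
        -- Stripping the steps of `E` one at a time shows that the child `s :: D` lies in the tree.
        induction E with
        | nil => exact hD'
        | cons e E ih => exact ih (hT.parent _ _ hD')
  choose next hbig using hnext
  let D : ℕ → {D // Big D} := fun n =>
    (fun D => ⟨next D :: D, hbig D⟩)^[n] ⟨[], hT.root, by simpa using hinf⟩
  refine ⟨fun n => (D n).1, fun n => next (D n), fun n => (D n).2.1, fun n => ?_⟩
  simp only [D]
  rw [Function.iterate_succ_apply']

end LogicProg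

theorem corollary1 {L : FirstOrder.Language.{u, v}} (P : LogicProg.Program L)
    (S : Set (LogicProg.Atom L)) (I : LogicProg.PolyInterp L)
    (hrigid : I.IsRigid (LogicProg.callSet P S))
    (R : LogicProg.Pred L → Set (LogicProg.Atom L))
    (hR : ∀ p, LogicProg.Occurs P p →
      LogicProg.IsInterargRel I.TermGE I.TermGT p (R p) ∧ LogicProg.IsValidRel P p (R p))
    (hdec : ∀ c ∈ P, ∀ i : Fin c.body.length,
      LogicProg.MutuallyRecursive P (c.body.get i).rel c.head.rel →
      ∀ θ : LogicProg.Subst L,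
        (∀ j : Fin c.body.length, j < i → (c.body.get j).subst θ ∈ R (c.body.get j).rel) →
        I.AtomGT (c.head.subst θ) ((c.body.get i).subst θ)) :
    ∀ Q ∈ S, LogicProg.LDTerminates P [Q] := by
  intro Q hQ T hT
  by_contra hinf
  obtain ⟨D, s, hD, hs⟩ := hT.exists_branch hinf
  have hres : ∀ n, LogicProg.Resolves P (LogicProg.goalAfter [Q] (D n)) (s n).mgu
      (LogicProg.goalAfter [Q] (D (n + 1))) := fun n => by
    have := hT.derivation _ (hD (n + 1))
    rw [hs] at this ⊢
    exact this.2.resolves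
  obtain ⟨A, hsel, hcalls⟩ := LogicProg.exists_calls_chain hres
  have hmem : ∀ k, A k ∈ LogicProg.callSet P S := fun k => by
    obtain ⟨n, hn⟩ := hsel k
    exact ⟨Q, hQ, D n, hT.derivation _ (hD n), A k, hn, (A k).isVariant_refl⟩
  have hrefers : ∀ k, LogicProg.RefersTo P (A k).rel (A (k + 1)).rel := fun k => by
    obtain ⟨c, hc, i, τ, ρ, hA, hB, -⟩ := hcalls k
    refine ⟨c, hc, (LogicProg.Atom.rel_eq_of_subst_eq hA).symm, c.body.get i, List.get_mem _ _, ?_⟩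
    rw [hB]; rfl
  obtain ⟨N, hN⟩ := LogicProg.exists_forall_mutuallyRecursive hrefers
  -- The orders on polynomials quantify over all valuations, so a single one, here zero, suffices.
  have hlt : ∀ k, N ≤ k → MvPolynomial.eval 0 (I.atomLevel (A (k + 1))) <
      MvPolynomial.eval 0 (I.atomLevel (A k)) := fun k hk => by
    have hmr := hN k hk
    obtain ⟨c, hc, i, τ, ρ, hA, hB, hent⟩ := hcalls k
    have h1 : (A k).rel = c.head.rel := LogicProg.Atom.rel_eq_of_subst_eq hA
    rw [h1, hB] at hmr
    have hgt := hdec c hc i hmr τ fun j hj =>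
      (hR _ ⟨c, hc, Or.inr ⟨_, List.get_mem _ _, rfl⟩⟩).2 _ (hent j hj)
    rw [hB]
    refine (hgt 0).trans_le ?_
    rw [← hA]
    -- Rigidity bounds the level of the instance `(A k).subst ρ`, which is the clause head under
    -- `τ`, by that of `A k`.
    exact (hrigid _ (hmem k) ρ).1 0
  exact not_strictAnti_of_wellFoundedLT
    (fun k => MvPolynomial.eval 0 (I.atomLevel (A (N + k))))
    (strictAnti_nat_of_succ_lt fun k => hlt (N + k) (by omega))
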